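/- Let $K$ be a field, let $S=K[t_1,\ldots,t_s]=\bigoplus_{d\ge 0}S_d$ be a polynomial ring with the standard grading, and let $\prec$ be a monomial order on $S$. For a graded ideal $J\subsetneq S$ put $H_J(d)=\dim_K S_d/(J\cap S_d)$, let $k=\dim(S/J)$ be the Krull dimension, and let $$\deg(S/J)=\begin{cases}(k-1)!\,\lim_{d\to\infty}H_J(d)/d^{\,k-1} & \text{if } k\ge 1,\\ \dim_K(S/J) & \text{if } k=0\end{cases}$$ be the degree of $S/J$. For $0\ne f\in S$ let $\mathrm{in}_\prec(f)$ be the leading monomial of $f$, put $\mathrm{in}_\prec(0)=0$, and for an ideal $I$ let $\mathrm{in}_\prec(I)$ be the ideal generated by all $\mathrm{in}_\prec(g)$ with $g\in I$. An ideal $I\subset S$ is called unmixed if all its associated primes (the prime ideals of the form $(I\colon g)$ with $g\in S$) have the same height. Let $I\subset S$ be an unmixed graded ideal and let $f\in S$ be a homogeneous polynomial with $(I\colon f)\ne I$, where $(I\colon f)=\{h\in S\mid hf\in I\}$. Then the degrees below are well defined (the limits exist when $k\geq 1$, and the dimensions are finite when $k=0$), $$\deg(S/(I,f))\le \deg(S/(\mathrm{in}_\prec(I),\mathrm{in}_\prec(f)))\le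 \deg(S/I),$$ and, if moreover $I$ is a radical ideal and $f\notin I$, then $\deg(S/(I,f))<\deg(S/I)$. -/

import Mathlib

open scoped Nat Topology

noncomputable section

namespace GradedDegree

attribute [local instance] MvPolynomial.gradedAlgebra

variable {K : Type*} [Field K] {s : ℕ}

/-- The Hilbert function `d ↦ dim_K (S_d / J_d)` of `S / J`, where `S = K[t_1, …, t_s]` has the
standard grading and `J_d = J ∩ S_d`. -/
def hilbertFunction (J : Ideal (MvPolynomial (Fin s) K)) (d : ℕ) : ℕ :=
  Module.finrank K
    (MvPolynomial.homogeneousSubmodule (Fin s) K d ⧸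
      (J.restrictScalars K).submoduleOf (MvPolynomial.homogeneousSubmodule (Fin s) K d))

/-- The Krull dimension of `S / J` as a natural number (it is at most `s`; the zero ring is
given the value `0`). -/
def dim (J : Ideal (MvPolynomial (Fin s) K)) : ℕ :=
  ((ringKrullDim (MvPolynomial (Fin s) K ⧸ J)).unbotD 0).toNat

/-- The sequence `(k - 1)! H_J(d) / d ^ (k - 1)`, with `k = dim S / J`, whose limit is the degree
when `k ≥ 1`. -/
def degreeSeq (J : Ideal (MvPolynomial (Fin s) K)) (d : ℕ) : ℝ :=
  ((dim J - 1)! : ℝ) * ((hilbertFunction J d : ℝ) / (d : ℝ) ^ (dim J - 1))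

open Classical in
/-- The degree (multiplicity) of `S / J`: the limit of `(k - 1)! H_J(d) / d ^ (k - 1)` if
`k = dim S / J ≥ 1`, and `dim_K (S / J)` if `k = 0`. -/
def degree (J : Ideal (MvPolynomial (Fin s) K)) : ℝ :=
  if dim J = 0 then (Module.finrank K (MvPolynomial (Fin s) K ⧸ J) : ℝ)
  else Filter.limUnder Filter.atTop (degreeSeq J)

/-- The quantity in the definition of the degree of `S / J` makes sense: the limit exists
(if `dim S / J ≥ 1`), respectively the vector space `S / J` is finite-dimensional
(if `dim S / J = 0`). -/
def DegreeExists (J : Ideal (MvPolynomial (Fin s) K)) : Prop :=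
  (dim J = 0 → Module.Finite K (MvPolynomial (Fin s) K ⧸ J)) ∧
  (dim J ≠ 0 → ∃ e : ℝ, Filter.Tendsto (degreeSeq J) Filter.atTop (𝓝 e))

/-- A graded ideal of `S` for the standard grading. -/
def IsGraded (J : Ideal (MvPolynomial (Fin s) K)) : Prop :=
  J.IsHomogeneous (MvPolynomial.homogeneousSubmodule (Fin s) K)

/-- An ideal is unmixed if all its associated primes have the same height. Associated primes are
the prime ideals of the form `(J : g)` with `g` in `S`. -/
def IsUnmixed (J : Ideal (MvPolynomial (Fin s) K)) : Prop :=
  ∀ p q : Ideal (MvPolynomial (Fin s) K),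
    (p.IsPrime ∧ ∃ g, p = J.colon {g}) → (q.IsPrime ∧ ∃ g, q = J.colon {g}) →
      p.height = q.height

open Classical in
/-- The leading (initial) monomial of a polynomial, with coefficient `1`; it is `0` for the zero
polynomial. -/
def initialMonomial (m : MonomialOrder (Fin s)) (f : MvPolynomial (Fin s) K) :
    MvPolynomial (Fin s) K :=
  if f = 0 then 0 else MvPolynomial.monomial (m.degree f) 1

/-- The initial ideal: the ideal generated by the initial monomials of the elements of `J`. -/
def initialIdeal (m : MonomialOrder (Fin s)) (J : Ideal (MvPolynomial (Fin s) K)) :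
    Ideal (MvPolynomial (Fin s) K) :=
  Ideal.span (initialMonomial m '' (J : Set (MvPolynomial (Fin s) K)))

end GradedDegree

end

/-! Everything is read off the affine Hilbert function `h_J(n)`, the dimension of the image of the
polynomials of degree at most `n` in `S/J`. For a proper graded `J` with `k = dim S/J`, the degree
is the limit of `k! h_J(n) / n^k`, also when `k = 0`. The limit exists and is positive because `h_J`
counts the monomials outside the leading exponents of `J`, such a count is eventually polynomial
(Dickson's lemma), and Noether normalization forces growth of order exactly `n^k`.

Since `(I : f) ≠ I`, the form `f` lies in an associated prime `p` of `I`. Unmixedness together with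
`height p + dim S/p = s` gives `dim S/p = dim S/I`, hence `dim S/(I,f) = dim S/I = k`. The leading
exponents of `(in I, in f)` lie between those of `I` and those of `(I,f)`, so its affine Hilbert
function lies between theirs. This forces the dimension to be `k` again, and the two weak
inequalities follow in the limit.

For strictness, multiplication by `f` embeds `S/(I : f)` in `S/I` with cokernel `S/(I,f)`. If `f ∉
I`, then `(I : f)` lies in an associated prime of `I`, so `S/(I : f)` also has dimension `k` and
takes a positive share of the leading coefficient. -/

/-! ### Krull dimension and height in polynomial rings. -/

theorem Algebra.IsIntegral.ringKrullDim_eq (R S : Type*) [CommRing R] [CommRing S] [Algebra R S]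
    [Algebra.IsIntegral R S] [FaithfulSMul R S] : ringKrullDim S = ringKrullDim R := by
  apply le_antisymm
  · refine Order.krullDim_le_of_strictMono (PrimeSpectrum.comap (algebraMap R S)) fun p q h => ?_
    exact Ideal.IsIntegral.comap_lt_comap (R := R) (A := S) h
  · rw [ringKrullDim, Order.krullDim, iSup_le_iff]
    intro l
    obtain ⟨⟨Q, hQ, hQl⟩⟩ := Ideal.nonempty_primesOver (S := S) (P := l.head.asIdeal)
    obtain ⟨L, hL, -⟩ := Ideal.exists_ltSeries_of_hasGoingUp (R := R) (S := S) l Q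
    rw [← hL]
    exact Order.LTSeries.length_le_krullDim L

namespace MvPolynomial

variable {K : Type*} [Field K]

/-- Split off one variable: the contraction to the remaining ones is again maximal by the Jacobson
property, and the height drops by exactly one. -/
theorem height_of_isMaximal {n : ℕ} (P : Ideal (MvPolynomial (Fin n) K)) [hP : P.IsMaximal] :
    P.height = n := by
  induction n with
  | zero =>
    have h := Ideal.height_le_ringKrullDim_of_ne_top hP.ne_top
    rw [MvPolynomial.ringKrullDim_of_isNoetherianRing, ringKrullDim_eq_zero_of_field] at h
    simpa using h
  | succ n ih =>
    let e := (finSuccEquiv K n).toRingEquiv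
    have hm : (P.map e).IsMaximal := Ideal.map_isMaximal_of_equiv e
    let p : Ideal (MvPolynomial (Fin n) K) := (P.map e).comap Polynomial.C
    have hp : p.IsMaximal := Polynomial.isMaximal_comap_C_of_isJacobsonRing _
    have : (P.map e).LiesOver p := ⟨rfl⟩
    have := Polynomial.height_eq_height_add_one p (P.map e)
    rw [RingEquiv.height_map e] at this
    rw [this, ih p]
    simp

theorem ringKrullDim_quotient_span_singleton_add_one {n : ℕ} {f : MvPolynomial (Fin n) K}
    (hf : f ≠ 0) (hu : ¬ IsUnit f) :
    ringKrullDim (MvPolynomial (Fin n) K ⧸ Ideal.span {f}) + 1 = n := by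
  obtain ⟨P, hP, hfP⟩ := exists_max_ideal_of_mem_nonunits hu
  have hd : ringKrullDim (MvPolynomial (Fin n) K) = n := by
    rw [MvPolynomial.ringKrullDim_of_isNoetherianRing, ringKrullDim_eq_zero_of_field]; simp
  rw [Module.ringKrullDim_quotient_add_one_of_mem_nonZeroDivisors (mem_nonZeroDivisors_of_ne_zero hf)
    (p := P) _ hfP, hd]
  rw [hd, height_of_isMaximal]; simp

end MvPolynomial

theorem RingHom.ringKrullDim_eq_of_isIntegral {R S : Type*} [CommRing R] [CommRing S] (g : R →+* S)
    (hg : Function.Injective g) (hi : g.IsIntegral) : ringKrullDim S = ringKrullDim R := by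
  let _ := g.toAlgebra
  have : Algebra.IsIntegral R S := ⟨hi⟩
  have : FaithfulSMul R S := (faithfulSMul_iff_algebraMap_injective _ _).mpr hg
  exact Algebra.IsIntegral.ringKrullDim_eq R S

theorem ringKrullDim_quotient_eq_coheight {R : Type*} [CommRing R] (q : Ideal R) [hq : q.IsPrime] :
    ringKrullDim (R ⧸ q) = (Order.coheight (⟨q, hq⟩ : PrimeSpectrum R) : WithBot ℕ∞) := by
  rw [ringKrullDim_quotient, Order.coheight_eq_krullDim_Ici]
  rfl

/-- A chain below `q` pulls back to primes containing `I ≠ 0`, so the zero prime of the domain can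
be put in front of it. -/
theorem Ideal.height_add_one_le_height_comap_quotient_mk {R : Type*} [CommRing R] [IsDomain R]
    [IsNoetherianRing R] {I : Ideal R} (hI : I ≠ ⊥) (q : Ideal (R ⧸ I)) [hq : q.IsPrime] :
    q.height + 1 ≤ (q.comap (Ideal.Quotient.mk I)).height := by
  obtain ⟨l, hl, hlen⟩ := q.exists_ltSeries_length_eq_height
  let l' : LTSeries (PrimeSpectrum R) := l.map (PrimeSpectrum.comap (Ideal.Quotient.mk I))
    (RingHom.strictMono_comap_of_surjective Ideal.Quotient.mk_surjective)
  have hb : (⟨⊥, Ideal.isPrime_bot⟩ : PrimeSpectrum R) < l'.head := by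
    rw [← PrimeSpectrum.asIdeal_lt_asIdeal]
    refine lt_of_lt_of_le (bot_lt_iff_ne_bot.mpr hI) ?_
    intro x hx
    simp [l', Ideal.Quotient.eq_zero_iff_mem.mpr hx]
  have h := Order.length_le_height (p := l'.cons _ hb)
    (x := ⟨q.comap (Ideal.Quotient.mk I), inferInstance⟩) (by simp [l', hl]; rfl)
  rw [← PrimeSpectrum.height_eq_orderHeight] at h
  rw [← hlen]
  simpa [l'] using h

theorem ringKrullDim_quotient_eq_of_liesOver {R S : Type*} [CommRing R] [CommRing S] [Algebra R S]
    [Algebra.IsIntegral R S] (p : Ideal R) (P : Ideal S) [P.LiesOver p] :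
    ringKrullDim (S ⧸ P) = ringKrullDim (R ⧸ p) :=
  Algebra.IsIntegral.ringKrullDim_eq _ _

/-- The height bound is going down over a normal domain; the dimensions agree because `S/Q` is
integral over the quotient by the contraction. -/
theorem Ideal.height_comap_le_and_ringKrullDim_quotient_of_isIntegral {R S : Type*} [CommRing R] [IsDomain R]
    [IsNoetherianRing R] [IsIntegrallyClosed R] [CommRing S] [IsDomain S] [IsNoetherianRing S] (g : R →+* S)
    (hg : Function.Injective g) (hi : g.IsIntegral) (Q : Ideal S) [Q.IsPrime] :
    (Q.comap g).height ≤ Q.height ∧ ringKrullDim (S ⧸ Q) = ringKrullDim (R ⧸ Q.comap g) := by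
  let _ := g.toAlgebra
  have : Algebra.IsIntegral R S := ⟨hi⟩
  have : FaithfulSMul R S := (faithfulSMul_iff_algebraMap_injective _ _).mpr hg
  have : Q.LiesOver (Q.comap g) := ⟨rfl⟩
  refine ⟨?_, ringKrullDim_quotient_eq_of_liesOver _ _⟩
  rw [Ideal.height_eq_height_add_of_liesOver_of_hasGoingDown (Q.comap g) Q]
  exact le_self_add

namespace MvPolynomial

variable {K : Type*} [Field K]

theorem ringKrullDim_fin (n : ℕ) : ringKrullDim (MvPolynomial (Fin n) K) = n := by
  rw [MvPolynomial.ringKrullDim_of_isNoetherianRing, ringKrullDim_eq_zero_of_field]; simp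

theorem exists_finite_inj_algHom_quotient {s : ℕ} (J : Ideal (MvPolynomial (Fin s) K))
    (hJ : J ≠ ⊤) {k : ℕ} (hk : ringKrullDim (MvPolynomial (Fin s) K ⧸ J) = k) :
    ∃ g : MvPolynomial (Fin k) K →ₐ[K] (MvPolynomial (Fin s) K ⧸ J),
      Function.Injective g ∧ g.Finite := by
  have := Ideal.Quotient.nontrivial_iff.mpr hJ
  obtain ⟨e, g, hg, hfin⟩ := exists_finite_inj_algHom_of_fg K (MvPolynomial (Fin s) K ⧸ J)
  suffices e = k by subst this; exact ⟨g, hg, hfin⟩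
  have h := RingHom.ringKrullDim_eq_of_isIntegral g.toRingHom hg (RingHom.Finite.to_isIntegral hfin)
  rw [hk, ringKrullDim_fin] at h
  exact_mod_cast h.symm

/-- Induction on the number of variables. A nonzero `q` contains a prime element `f`; the
hypersurface ring `S/(f)` is finite over a polynomial ring in `n - 1` variables, and the induction
hypothesis is applied to the contraction of `q/(f)` there. -/
theorem le_height_add_ringKrullDim_quotient {n : ℕ} (q : Ideal (MvPolynomial (Fin n) K))
    [hq : q.IsPrime] :
    (n : WithBot ℕ∞) ≤ q.height + ringKrullDim (MvPolynomial (Fin n) K ⧸ q) := by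
  induction n using Nat.strong_induction_on with
  | _ n ih =>
  by_cases hq0 : q = ⊥
  · subst hq0
    rw [Ideal.height_bot, ringKrullDim_eq_of_ringEquiv (RingEquiv.quotientBot _),
      ringKrullDim_fin]
    simp
  obtain ⟨f, hfq, hf⟩ := hq.exists_mem_prime_of_ne_bot hq0
  have hI : (Ideal.span {f}).IsPrime := (Ideal.span_singleton_prime hf.ne_zero).mpr hf
  have hle : Ideal.span {f} ≤ q := by simpa [Ideal.span_le] using hfq
  have hd := ringKrullDim_quotient_span_singleton_add_one hf.ne_zero hf.not_isUnit
  obtain ⟨e, g, hg, hfin⟩ := exists_finite_inj_algHom_of_fg K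
    (MvPolynomial (Fin n) K ⧸ Ideal.span {f})
  have hi := RingHom.Finite.to_isIntegral hfin
  have he := RingHom.ringKrullDim_eq_of_isIntegral g.toRingHom hg hi
  rw [ringKrullDim_fin] at he
  have hn : e + 1 = n := by rw [he] at hd; exact_mod_cast hd
  have hker : RingHom.ker (Ideal.Quotient.mk (Ideal.span {f})) ≤ q := by
    rwa [Ideal.mk_ker]
  let Q := q.map (Ideal.Quotient.mk (Ideal.span {f}))
  have hQ : Q.IsPrime := Ideal.map_isPrime_of_surjective Ideal.Quotient.mk_surjective hker
  have hQq : Q.comap (Ideal.Quotient.mk (Ideal.span {f})) = q := by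
    rw [Ideal.comap_map_of_surjective _ Ideal.Quotient.mk_surjective]
    rw [← RingHom.ker_eq_comap_bot, Ideal.mk_ker]
    exact sup_eq_left.mpr hle
  obtain ⟨h1, h2⟩ := Ideal.height_comap_le_and_ringKrullDim_quotient_of_isIntegral g.toRingHom hg hi Q
  have h3 := ih e (by omega) (Q.comap g.toRingHom)
  have h4 := Ideal.height_add_one_le_height_comap_quotient_mk
    (by simpa using hf.ne_zero : Ideal.span {f} ≠ ⊥) Q
  rw [hQq] at h4
  have h5 : ringKrullDim ((MvPolynomial (Fin n) K ⧸ Ideal.span {f}) ⧸ Q) =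
      ringKrullDim (MvPolynomial (Fin n) K ⧸ q) :=
    ringKrullDim_eq_of_ringEquiv (DoubleQuot.quotQuotEquivQuotOfLE hle)
  rw [← h2, h5] at h3
  calc (n : WithBot ℕ∞) = (e : WithBot ℕ∞) + 1 := by rw [← hn]; push_cast; rfl
    _ ≤ (Q.comap g.toRingHom).height + ringKrullDim (MvPolynomial (Fin n) K ⧸ q) + 1 := by gcongr
    _ = ((Q.comap g.toRingHom).height + 1 : ℕ∞) + ringKrullDim (MvPolynomial (Fin n) K ⧸ q) := by
        push_cast; rw [add_right_comm]
    _ ≤ _ := by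
        gcongr
        exact WithBot.coe_le_coe.mpr ((add_le_add_left h1 1).trans h4)

theorem height_add_ringKrullDim_quotient {n : ℕ} (q : Ideal (MvPolynomial (Fin n) K))
    [hq : q.IsPrime] :
    (q.height : WithBot ℕ∞) + ringKrullDim (MvPolynomial (Fin n) K ⧸ q) = n := by
  refine le_antisymm ?_ (le_height_add_ringKrullDim_quotient q)
  rw [ringKrullDim_quotient_eq_coheight, ← ringKrullDim_fin (K := K) n, ringKrullDim,
    Order.krullDim_eq_iSup_height_add_coheight_of_nonempty,
    PrimeSpectrum.height_eq_orderHeight ⟨q, hq⟩, ← WithBot.coe_add, WithBot.coe_le_coe]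
  exact le_iSup (fun a : PrimeSpectrum (MvPolynomial (Fin n) K) =>
    Order.height a + Order.coheight a) ⟨q, hq⟩

theorem ringKrullDim_quotient_eq_of_height_eq {n : ℕ} (p q : Ideal (MvPolynomial (Fin n) K))
    [p.IsPrime] [q.IsPrime] (h : p.height = q.height) :
    ringKrullDim (MvPolynomial (Fin n) K ⧸ p) = ringKrullDim (MvPolynomial (Fin n) K ⧸ q) := by
  have hp := height_add_ringKrullDim_quotient p
  have hq := height_add_ringKrullDim_quotient q
  rw [ringKrullDim_quotient_eq_coheight] at hp hq ⊢
  rw [ringKrullDim_quotient_eq_coheight]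
  rw [h] at hp
  rw [← hq] at hp
  norm_cast at hp ⊢
  exact ENat.add_right_injective_of_ne_top Ideal.height_ne_top_of_isPrime hp

end MvPolynomial

/-! ### Minimal and associated primes. -/

theorem ringKrullDim_quotient_le_of_minimalPrimes {R : Type*} [CommRing R] {I : Ideal R}
    {k : WithBot ℕ∞} (h : ∀ p ∈ I.minimalPrimes, ringKrullDim (R ⧸ p) ≤ k) :
    ringKrullDim (R ⧸ I) ≤ k := by
  rw [ringKrullDim_quotient, Order.krullDim, iSup_le_iff]
  intro l
  obtain ⟨p, hp, hpl⟩ := Ideal.exists_minimalPrimes_le (J := l.head.1.asIdeal) l.head.2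
  have := hp.1.1
  refine le_trans ?_ (h p hp)
  rw [ringKrullDim_quotient_eq_coheight]
  have := Order.length_le_coheight (p := l.map Subtype.val (fun _ _ => id))
    (x := ⟨p, hp.1.1⟩) hpl
  exact_mod_cast this

theorem Submodule.mem_associatedPrimes_of_mem_minimalPrimes {R : Type*} [CommRing R]
    [IsNoetherianRing R] {I p : Ideal R} (hp : p ∈ I.minimalPrimes) :
    p.IsPrime ∧ ∃ g, p = I.colon {g} := by
  have h : p ∈ associatedPrimes R (R ⧸ I) :=
    Module.associatedPrimes.minimalPrimes_annihilator_subset_associatedPrimes R (R ⧸ I)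
      (by rwa [Ideal.annihilator_quotient])
  obtain ⟨h1, x, hx⟩ := isAssociatedPrime_iff.mp h
  obtain ⟨g, rfl⟩ := Ideal.Quotient.mk_surjective x
  refine ⟨h1, g, ?_⟩
  rw [hx]
  ext r
  simp only [Submodule.mem_colon_singleton, Submodule.mem_bot, Algebra.smul_def,
    Ideal.Quotient.algebraMap_eq, ← map_mul, Ideal.Quotient.eq_zero_iff_mem]
  rfl

theorem Ideal.exists_isPrime_colon_le_colon {R : Type*} [CommRing R] [IsNoetherianRing R]
    {I : Ideal R} {h : R} (hh : h ∉ I) :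
    ∃ p : Ideal R, (p.IsPrime ∧ ∃ g, p = I.colon {g}) ∧ I.colon {h} ≤ p := by
  have hx : Ideal.Quotient.mk I h ≠ 0 := by rwa [Ne, Ideal.Quotient.eq_zero_iff_mem]
  obtain ⟨p, hp, hle⟩ := exists_le_isAssociatedPrime_of_isNoetherianRing R _ hx
  obtain ⟨h1, x, hx⟩ := isAssociatedPrime_iff.mp hp
  obtain ⟨g, rfl⟩ := Ideal.Quotient.mk_surjective x
  have key : ∀ g : R, (⊥ : Submodule R (R ⧸ I)).colon {Ideal.Quotient.mk I g} = I.colon {g} := by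
    intro g
    ext r
    simp only [Submodule.mem_colon_singleton, Submodule.mem_bot, Algebra.smul_def,
      Ideal.Quotient.algebraMap_eq, ← map_mul, Ideal.Quotient.eq_zero_iff_mem]
    rfl
  exact ⟨p, ⟨h1, g, hx.trans (key g)⟩, (key h) ▸ hle⟩

theorem RingHom.Finite.exists_fin_eq_sum {R S : Type*} [CommRing R] [CommRing S] {g : R →+* S}
    (hg : g.Finite) : ∃ (N : ℕ) (a : Fin N → S), ∀ x, ∃ b : Fin N → R, x = ∑ l, g (b l) * a l := by
  let _ := g.toAlgebra
  have : Module.Finite R S := hg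
  obtain ⟨N, a, ha⟩ := Module.Finite.exists_fin (R := R) (M := S)
  refine ⟨N, a, fun x => ?_⟩
  have hx : x ∈ Submodule.span R (Set.range a) := ha ▸ Submodule.mem_top
  obtain ⟨b, hb⟩ := (Submodule.mem_span_range_iff_exists_fun _).mp hx
  exact ⟨b, by rw [← hb]; rfl⟩

/-! ### Growth of the affine Hilbert function by Noether normalization. -/

namespace MvPolynomial

variable {K : Type*} [Field K]

theorem totalDegree_aeval_le {σ τ R : Type*} [CommRing R] {r : ℕ}
    (p : σ → MvPolynomial τ R) (hp : ∀ i, (p i).totalDegree ≤ r) (q : MvPolynomial σ R) :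
    (aeval p q).totalDegree ≤ r * q.totalDegree := by
  rw [aeval_def, eval₂_eq]
  refine totalDegree_finsetSum_le fun a ha => ?_
  refine (totalDegree_mul _ _).trans ?_
  rw [algebraMap_eq, totalDegree_C, zero_add]
  refine (totalDegree_finsetProd _ _).trans ?_
  calc ∑ i ∈ a.support, (p i ^ a i).totalDegree ≤ ∑ i ∈ a.support, a i * r := by
        refine Finset.sum_le_sum fun i _ => (totalDegree_pow _ _).trans ?_
        exact Nat.mul_le_mul_left _ (hp i)
    _ = r * a.sum fun _ e => e := by rw [← Finset.sum_mul, mul_comm]; rfl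
    _ ≤ _ := Nat.mul_le_mul_left _ (le_totalDegree ha)

theorem finrank_restrictSupport {σ : Type*} (T : Set (σ →₀ ℕ)) :
    Module.finrank K (restrictSupport K T) = T.ncard := by
  rw [Module.finrank_eq_nat_card_basis (basisRestrictSupport K T)]
  rfl

theorem finite_restrictSupport {σ : Type*} {T : Set (σ →₀ ℕ)} (hT : T.Finite) :
    Module.Finite K (restrictSupport K T) := by
  have := hT.to_subtype
  exact Module.Finite.of_basis (basisRestrictSupport K T)

theorem ncard_box (k n : ℕ) : {a : Fin k →₀ ℕ | ∀ i, a i ≤ n}.ncard = (n + 1) ^ k := by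
  let e : {a : Fin k →₀ ℕ | ∀ i, a i ≤ n} ≃ (Fin k → Fin (n + 1)) :=
    { toFun := fun a i => ⟨a.1 i, Nat.lt_succ_of_le (a.2 i)⟩
      invFun := fun b => ⟨Finsupp.equivFunOnFinite.symm fun i => (b i : ℕ),
        fun i => Nat.le_of_lt_succ (b i).2⟩
      left_inv := fun a => by ext; rfl
      right_inv := fun b => rfl }
  rw [← Nat.card_coe_set_eq, Nat.card_congr e]
  simp

theorem finite_box (k n : ℕ) : {a : Fin k →₀ ℕ | ∀ i, a i ≤ n}.Finite :=
  Set.finite_of_ncard_pos (by rw [ncard_box]; positivity)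

end MvPolynomial

namespace GradedDegree

open MvPolynomial

variable {K : Type*} [Field K] {s : ℕ}

/-- The dimension of the image in `S / J` of the polynomials of total degree at most `d`. -/
noncomputable def affineHilbertFunction (J : Ideal (MvPolynomial (Fin s) K)) (d : ℕ) : ℕ :=
  Module.finrank K ((restrictTotalDegree (Fin s) K d).map (Ideal.Quotient.mkₐ K J).toLinearMap)

/-- The `(n + 1)^k` monomials with all exponents at most `n` stay independent under `g`, and lifting
the images of the variables bounds the degrees of their representatives linearly in `n`. -/
theorem pow_le_affineHilbertFunction {J : Ideal (MvPolynomial (Fin s) K)} {k : ℕ}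
    (g : MvPolynomial (Fin k) K →ₐ[K] (MvPolynomial (Fin s) K ⧸ J)) (hg : Function.Injective g) :
    ∃ r, 0 < r ∧ ∀ n, (n + 1) ^ k ≤ affineHilbertFunction J (r * n) := by
  choose p hp using fun i => Ideal.Quotient.mk_surjective (I := J) (g (X i))
  obtain ⟨r, hr⟩ : ∃ r, ∀ i, (p i).totalDegree ≤ r :=
    ⟨Finset.univ.sup fun i => (p i).totalDegree,
      fun i => Finset.le_sup (f := fun i => (p i).totalDegree) (Finset.mem_univ i)⟩
  have hgp : ∀ q, g q = Ideal.Quotient.mkₐ K J (aeval p q) := by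
    intro q
    have : g = (Ideal.Quotient.mkₐ K J).comp (aeval p) := by
      ext i
      simp [hp]
    rw [this]; rfl
  -- Monomials in the box have degree at most `k * n`, and substitution multiplies degrees by at
  -- most `r`; the `+ 1` only secures positivity.
  refine ⟨r * k + 1, by omega, fun n => ?_⟩
  rw [← ncard_box, ← finrank_restrictSupport (K := K),
    (Submodule.equivMapOfInjective g.toLinearMap hg _).finrank_eq]
  apply Submodule.finrank_mono
  rintro _ ⟨q, hq, rfl⟩
  refine ⟨aeval p q, ?_, (hgp q).symm⟩
  rw [SetLike.mem_coe, mem_restrictTotalDegree]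
  refine (totalDegree_aeval_le p hr q).trans ?_
  have : q.totalDegree ≤ k * n := by
    rw [totalDegree_eq]
    refine Finset.sup_le fun a ha => ?_
    have h : ∀ i, a i ≤ n := (mem_restrictSupport_iff K).mp hq ha
    rw [Finsupp.card_toMultiset, Finsupp.sum_fintype _ _ (fun _ => rfl)]
    calc ∑ i, a i ≤ ∑ i : Fin k, n := Finset.sum_le_sum fun i _ => h i
      _ = k * n := by simp
  nlinarith [Nat.mul_le_mul_left r this]

/-- Multiplication by each variable acts on the module generators through a fixed matrix of
polynomials. Each such step raises coefficient degrees by at most a constant `R`, which is also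
chosen to bound the coefficients of `1`; hence `R * (n + 1)`. -/
theorem exists_repr_of_totalDegree_le {J : Ideal (MvPolynomial (Fin s) K)} {k : ℕ}
    (g : MvPolynomial (Fin k) K →ₐ[K] (MvPolynomial (Fin s) K ⧸ J)) (hg : g.Finite) :
    ∃ (N R : ℕ) (a : Fin N → (MvPolynomial (Fin s) K ⧸ J)), ∀ n (q : MvPolynomial (Fin s) K),
      q.totalDegree ≤ n → ∃ b : Fin N → MvPolynomial (Fin k) K,
        (∀ l, (b l).totalDegree ≤ R * (n + 1)) ∧ Ideal.Quotient.mk J q = ∑ l, g (b l) * a l := by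
  obtain ⟨N, a, ha⟩ : ∃ (N : ℕ) (a : Fin N → (MvPolynomial (Fin s) K ⧸ J)),
      ∀ x, ∃ b : Fin N → MvPolynomial (Fin k) K, x = ∑ l, g (b l) * a l := 
    RingHom.Finite.exists_fin_eq_sum hg
  obtain ⟨b₁, hb₁⟩ := ha 1
  choose B hB using fun (i : Fin s) (l : Fin N) => ha (Ideal.Quotient.mk J (X i) * a l)
  let R := (∑ l, (b₁ l).totalDegree) + ∑ i, ∑ l, ∑ m, (B i l m).totalDegree
  have hR₁ : ∀ l, (b₁ l).totalDegree ≤ R := fun l =>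
    (Finset.single_le_sum (f := fun l => (b₁ l).totalDegree) (fun _ _ => Nat.zero_le _)
      (Finset.mem_univ l)).trans (Nat.le_add_right _ _)
  have hRB : ∀ i l m, (B i l m).totalDegree ≤ R := fun i l m =>
    (((Finset.single_le_sum (f := fun m => (B i l m).totalDegree) (fun _ _ => Nat.zero_le _)
      (Finset.mem_univ m)).trans (Finset.single_le_sum
        (f := fun l => ∑ m, (B i l m).totalDegree) (fun _ _ => Nat.zero_le _)
      (Finset.mem_univ l))).trans (Finset.single_le_sum
        (f := fun i => ∑ l, ∑ m, (B i l m).totalDegree) (fun _ _ => Nat.zero_le _)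
      (Finset.mem_univ i))).trans (Nat.le_add_left _ _)
  let W : ℕ → Submodule K (MvPolynomial (Fin s) K ⧸ J) := fun n =>
    { carrier := {x | ∃ b : Fin N → MvPolynomial (Fin k) K,
        (∀ l, (b l).totalDegree ≤ R * (n + 1)) ∧ x = ∑ l, g (b l) * a l}
      add_mem' := by
        rintro _ _ ⟨b, hb, rfl⟩ ⟨c, hc, rfl⟩
        refine ⟨b + c, fun l => (totalDegree_add _ _).trans (max_le (hb l) (hc l)), ?_⟩
        simp [add_mul, Finset.sum_add_distrib]
      zero_mem' := ⟨0, by simp, by simp⟩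
      smul_mem' := by
        rintro c _ ⟨b, hb, rfl⟩
        refine ⟨c • b, fun l => (totalDegree_smul_le _ _).trans (hb l), ?_⟩
        simp [Finset.smul_sum, smul_mul_assoc] }
  have hW : Monotone W := by
    rintro n m hnm _ ⟨b, hb, rfl⟩
    exact ⟨b, fun l => (hb l).trans (Nat.mul_le_mul_left _ (by omega)), rfl⟩
  have hX : ∀ n i, ∀ x ∈ W n, Ideal.Quotient.mk J (X i) * x ∈ W (n + 1) := by
    rintro n i _ ⟨b, hb, rfl⟩
    refine ⟨fun m => ∑ l, b l * B i l m, fun m => ?_, ?_⟩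
    · refine totalDegree_finsetSum_le fun l _ => (totalDegree_mul _ _).trans ?_
      have := hb l
      have := hRB i l m
      nlinarith
    · simp_rw [Finset.mul_sum, map_sum, Finset.sum_mul]
      rw [Finset.sum_comm]
      refine Finset.sum_congr rfl fun l _ => ?_
      rw [mul_left_comm, hB, Finset.mul_sum]
      simp [mul_assoc]
  have hmon : ∀ n (d : Fin s →₀ ℕ), d.degree = n → Ideal.Quotient.mk J (monomial d 1) ∈ W n := by
    intro n
    induction n with
    | zero =>
      intro d hd
      rw [Finsupp.degree_eq_zero_iff] at hd
      subst hd
      exact ⟨b₁, fun l => (hR₁ l).trans (by simp), by simpa using hb₁⟩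
    | succ n ih =>
      intro d hd
      obtain ⟨i, hi⟩ : ∃ i, d i ≠ 0 := by
        by_contra! h
        have : d = 0 := Finsupp.ext h
        simp [this] at hd
      have hle : Finsupp.single i 1 ≤ d := by
        rw [Finsupp.single_le_iff]; omega
      have hd' : d = Finsupp.single i 1 + (d - Finsupp.single i 1) :=
        (add_tsub_cancel_of_le hle).symm
      have h1 : (d - Finsupp.single i 1).degree = n := by
        rw [hd', map_add, Finsupp.degree_single] at hd; omega
      rw [hd', ← one_mul (1 : K), ← monomial_mul, map_mul]
      exact hX n i _ (ih _ h1)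
  refine ⟨N, R, a, fun n q hq => ?_⟩
  suffices Ideal.Quotient.mkₐ K J q ∈ W n from this
  rw [q.as_sum, map_sum]
  refine Submodule.sum_mem _ fun d hd => ?_
  have : monomial d (coeff d q) = coeff d q • monomial d (1 : K) := by simp [smul_monomial]
  rw [this, map_smul]
  refine Submodule.smul_mem _ _ (hW ?_ (hmon _ d rfl))
  exact (le_totalDegree hd).trans hq

theorem affineHilbertFunction_le {J : Ideal (MvPolynomial (Fin s) K)} {k : ℕ}
    (g : MvPolynomial (Fin k) K →ₐ[K] (MvPolynomial (Fin s) K ⧸ J)) (hg : g.Finite) :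
    ∃ C R : ℕ, ∀ n, affineHilbertFunction J n ≤ C * (R * (n + 1) + 1) ^ k := by
  obtain ⟨N, R, a, h⟩ := exists_repr_of_totalDegree_le g hg
  refine ⟨N, R, fun n => ?_⟩
  let T := restrictSupport K {a : Fin k →₀ ℕ | ∀ i, a i ≤ R * (n + 1)}
  have : Module.Finite K T := finite_restrictSupport (finite_box _ _)
  let Φ : (Fin N → T) →ₗ[K] (MvPolynomial (Fin s) K ⧸ J) :=
    ∑ l, (LinearMap.mulRight K (a l)) ∘ₗ g.toLinearMap ∘ₗ T.subtype ∘ₗ LinearMap.proj l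
  have hle : (restrictTotalDegree (Fin s) K n).map (Ideal.Quotient.mkₐ K J).toLinearMap ≤
      LinearMap.range Φ := by
    rintro _ ⟨q, hq, rfl⟩
    rw [SetLike.mem_coe, mem_restrictTotalDegree] at hq
    obtain ⟨b, hb, hq'⟩ := h n q hq
    refine ⟨fun l => ⟨b l, ?_⟩, ?_⟩
    · have := restrictTotalDegree_le_restrictDegree (Fin k) K _
        ((mem_restrictTotalDegree _ _ _).mpr (hb l))
      exact this
    · simpa [Φ] using hq'.symm
  calc affineHilbertFunction J n ≤ Module.finrank K (LinearMap.range Φ) :=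
        Submodule.finrank_mono hle
    _ ≤ Module.finrank K (Fin N → T) := LinearMap.finrank_range_le Φ
    _ = _ := by
      rw [Module.finrank_pi_fintype]
      simp [T, finrank_restrictSupport, ncard_box]

end GradedDegree

/-! ### Eventually polynomial sequences and monomials outside an upper set. -/

section

open Filter Topology

/-- A sequence is eventually polynomial if some iterated forward difference of it is eventually
zero. -/
def EventuallyPolynomial (f : ℕ → ℝ) : Prop :=
  ∃ N : ℕ, ∀ᶠ d in atTop, (fwdDiff 1)^[N] f d = 0

theorem eventually_fwdDiff_iterate_eq_zero {f : ℕ → ℝ} (hf : ∀ᶠ d in atTop, f d = 0) (N : ℕ) :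
    ∀ᶠ d in atTop, (fwdDiff 1)^[N] f d = 0 := by
  induction N with
  | zero => exact hf
  | succ N ih =>
    obtain ⟨D, hD⟩ := eventually_atTop.mp ih
    refine eventually_atTop.mpr ⟨D, fun d hd => ?_⟩
    rw [Function.iterate_succ_apply', fwdDiff, hD d hd, hD (d + 1) (by omega), sub_zero]

theorem eventually_fwdDiff_iterate_eq_zero_of_le {f : ℕ → ℝ} {M N : ℕ} (h : M ≤ N)
    (hf : ∀ᶠ d in atTop, (fwdDiff 1)^[M] f d = 0) :
    ∀ᶠ d in atTop, (fwdDiff 1)^[N] f d = 0 := by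
  obtain ⟨j, rfl⟩ := Nat.exists_eq_add_of_le' h
  rw [Function.iterate_add]
  exact eventually_fwdDiff_iterate_eq_zero hf j

namespace EventuallyPolynomial

theorem of_eventually_eq_zero {f : ℕ → ℝ} (hf : ∀ᶠ d in atTop, f d = 0) :
    EventuallyPolynomial f := ⟨0, hf⟩

theorem add {f g : ℕ → ℝ} (hf : EventuallyPolynomial f) (hg : EventuallyPolynomial g) :
    EventuallyPolynomial (f + g) := by
  obtain ⟨M, hM⟩ := hf
  obtain ⟨N, hN⟩ := hg
  refine ⟨max M N, ?_⟩
  filter_upwards [eventually_fwdDiff_iterate_eq_zero_of_le (le_max_left M N) hM,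
    eventually_fwdDiff_iterate_eq_zero_of_le (le_max_right M N) hN] with d h1 h2
  rw [fwdDiff_iter_add, Pi.add_apply, h1, h2, add_zero]

theorem comp_add_one_iff {f : ℕ → ℝ} :
    EventuallyPolynomial (fun d => f (d + 1)) ↔ EventuallyPolynomial f := by
  refine exists_congr fun N => ?_
  simp_rw [fwdDiff_iter_comp_add]
  constructor <;> intro h <;> obtain ⟨D, hD⟩ := eventually_atTop.mp h
  · refine eventually_atTop.mpr ⟨D + 1, fun d hd => ?_⟩
    have := hD (d - 1) (by omega)
    rwa [Nat.sub_add_cancel (by omega)] at this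
  · exact eventually_atTop.mpr ⟨D, fun d hd => hD _ (by omega)⟩

theorem of_fwdDiff {f : ℕ → ℝ} (hf : EventuallyPolynomial (fwdDiff 1 f)) :
    EventuallyPolynomial f := by
  obtain ⟨N, hN⟩ := hf
  exact ⟨N + 1, by simpa only [Function.iterate_succ_apply] using hN⟩

end EventuallyPolynomial

section Counting

variable {σ : Type*}

/-- The number of exponents of degree `d` with support in `A` that do not lie in `U`. -/
noncomputable def complementCount (U : Set (σ →₀ ℕ)) (A : Finset σ) (d : ℕ) : ℕ :=
  {a : σ →₀ ℕ | a.degree = d ∧ a.support ⊆ A ∧ a ∉ U}.ncard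

theorem Finsupp.finite_setOf_degree_eq [Finite σ] (d : ℕ) : {a : σ →₀ ℕ | a.degree = d}.Finite :=
  (Finsupp.finite_of_degree_le d).subset fun _ h => le_of_eq h

/-- Either the variable `i` does not occur in the monomial, or one factor of it can be divided out.
-/
theorem complementCount_insert_succ [Finite σ] [DecidableEq σ] (U : Set (σ →₀ ℕ)) {A : Finset σ}
    {i : σ} (hi : i ∉ A) (d : ℕ) :
    complementCount U (insert i A) (d + 1) = complementCount U A (d + 1) +
      complementCount {a | a + Finsupp.single i 1 ∈ U} (insert i A) d := by
  unfold complementCount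
  have hinj : Function.Injective fun a : σ →₀ ℕ => a + Finsupp.single i 1 :=
    add_left_injective _
  rw [← Set.ncard_image_of_injective {a : σ →₀ ℕ | a.degree = d ∧ a.support ⊆ insert i A ∧
    a ∉ {a | a + Finsupp.single i 1 ∈ U}} hinj, ← Set.ncard_union_eq ?_
      ((Finsupp.finite_setOf_degree_eq (d + 1)).subset fun a h => h.1)
      (((Finsupp.finite_setOf_degree_eq d).subset fun a h => h.1).image _)]
  · congr 1
    ext a
    simp only [Set.mem_ofPred_eq, Set.mem_union, Set.mem_image]
    constructor
    · rintro ⟨h1, h2, h3⟩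
      by_cases ha : a i = 0
      · refine Or.inl ⟨h1, fun j hj => ?_, h3⟩
        rcases Finset.mem_insert.mp (h2 hj) with rfl | h
        · simp [ha] at hj
        · exact h
      · have hle : Finsupp.single i 1 ≤ a := by rw [Finsupp.single_le_iff]; omega
        have hd := tsub_add_cancel_of_le hle
        refine Or.inr ⟨a - Finsupp.single i 1, ⟨?_, ?_, by rwa [hd]⟩, hd⟩
        · rw [← hd, map_add, Finsupp.degree_single] at h1; omega
        · exact (Finsupp.support_mono tsub_le_self).trans h2
    · rintro (⟨h1, h2, h3⟩ | ⟨b, ⟨h1, h2, h3⟩, rfl⟩)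
      · exact ⟨h1, h2.trans (Finset.subset_insert _ _), h3⟩
      · refine ⟨by rw [map_add, h1, Finsupp.degree_single], ?_, h3⟩
        refine Finsupp.support_add.trans (Finset.union_subset h2 ?_)
        exact Finsupp.support_single_subset.trans (by simp)
  · rw [Set.disjoint_left]
    rintro _ ⟨-, h2, -⟩ ⟨b, -, rfl⟩
    exact hi (h2 (by simp))

/-- Dickson's lemma: witnesses of infinitely many strict steps would form a sequence with no
comparable pair `i < j`, `a i ≤ a j`. -/
theorem IsUpperSet.exists_succ_subset [Finite σ] {U : ℕ → Set (σ →₀ ℕ)}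
    (hU : ∀ n, IsUpperSet (U n)) (hmono : Monotone U) : ∃ n, U (n + 1) ⊆ U n := by
  by_contra! h
  choose a ha ha' using fun n => Set.not_subset.mp (h n)
  obtain ⟨i, j, hij, hle⟩ := wellQuasiOrdered_le (α := σ →₀ ℕ) a
  exact ha' j (hU j hle (hmono hij (ha i)))

/-- Induction on the set of variables, applied to the ascending chain of sets obtained from `U` by
dividing by powers of the new variable. -/
theorem eventuallyPolynomial_complementCount [Finite σ] {U : Set (σ →₀ ℕ)} (hU : IsUpperSet U)
    (A : Finset σ) : EventuallyPolynomial fun d => (complementCount U A d : ℝ) := by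
  classical
  induction A using Finset.induction_on generalizing U with
  | empty =>
    refine .of_eventually_eq_zero (eventually_atTop.mpr ⟨1, fun d hd => ?_⟩)
    have : {a : σ →₀ ℕ | a.degree = d ∧ a.support ⊆ ∅ ∧ a ∉ U} = ∅ := by
      ext a
      simp only [Set.mem_ofPred_eq, Set.mem_empty_iff_false, iff_false, not_and]
      rintro h1 h2
      rw [Finset.subset_empty, Finsupp.support_eq_empty] at h2
      simp [h2] at h1
      omega
    rw [complementCount, this]
    simp
  | insert i A hi ih =>
    let V : ℕ → Set (σ →₀ ℕ) := fun n => {a | a + Finsupp.single i n ∈ U}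
    have hV : ∀ n, IsUpperSet (V n) := fun n a b hab ha =>
      hU (add_le_add_left hab _) ha
    have hmono : Monotone V := fun m n hmn a ha =>
      hU (add_le_add_right (Finsupp.single_mono hmn) _) ha
    have hsucc : ∀ n, {a | a + Finsupp.single i 1 ∈ V n} = V (n + 1) := fun n => by
      ext a
      simp only [V, Set.mem_ofPred_eq, add_assoc, ← Finsupp.single_add, add_comm 1 n]
    have hrec : ∀ n d, complementCount (V n) (insert i A) (d + 1) =
        complementCount (V n) A (d + 1) + complementCount (V (n + 1)) (insert i A) d := by
      intro n d
      rw [complementCount_insert_succ _ hi, hsucc]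
    obtain ⟨n, hn⟩ := IsUpperSet.exists_succ_subset hV hmono
    have hn' : V (n + 1) = V n := hn.antisymm (hmono n.le_succ)
    -- Descent along the chain from `V n` to `V 0 = U`. At `V n = V (n + 1)` the recursion expresses
    -- the first difference through fewer variables; below, it expresses `V (n - j - 1)` through `V
    -- (n - j)`.
    have key : ∀ j ≤ n, EventuallyPolynomial
        fun d => (complementCount (V (n - j)) (insert i A) d : ℝ) := by
      intro j hj
      induction j with
      | zero =>
        apply EventuallyPolynomial.of_fwdDiff
        convert EventuallyPolynomial.comp_add_one_iff.mpr (ih (hV n)) using 2 with d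
        rw [fwdDiff, Nat.sub_zero, hrec, hn']
        push_cast
        ring
      | succ j h =>
        rw [← EventuallyPolynomial.comp_add_one_iff]
        convert (EventuallyPolynomial.comp_add_one_iff.mpr (ih (hV (n - (j + 1))))).add
          (h (by omega)) using 2 with d
        simp [hrec, show n - (j + 1) + 1 = n - j by omega]
    have h0 : V 0 = U := by ext a; simp [V]
    simpa [h0] using key n le_rfl

end Counting

end

/-! ### Leading coefficients from iterated differences. -/

section

open Filter Topology

/-- Newton's expansion at `D` is a finite combination of binomials `n.choose j` with `j ≤ K`; as
`n.choose j ~ n^j / j!`, only `j = K` survives division by `n^K`. -/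
theorem fwdDiff_iterate_tendsto {f : ℕ → ℝ} {D K : ℕ}
    (hK : ∀ j, K < j → (fwdDiff 1)^[j] f D = 0) :
    Tendsto (fun n : ℕ => f n / (n : ℝ) ^ K) atTop (𝓝 ((fwdDiff 1)^[K] f D / K.factorial)) := by
  have hnewton : ∀ n : ℕ, f (n + D) =
      ∑ j ∈ Finset.range (K + 1), (fwdDiff 1)^[j] f D * (n.choose j : ℝ) := by
    intro n
    have h := shift_eq_sum_fwdDiff_iter 1 f n D
    rw [smul_eq_mul, mul_one, add_comm D n] at h
    rw [h]
    have h1 : ∀ M, n ≤ M → ∑ j ∈ Finset.range (n + 1), n.choose j • (fwdDiff 1)^[j] f D =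
        ∑ j ∈ Finset.range (M + 1), (fwdDiff 1)^[j] f D * (n.choose j : ℝ) := by
      intro M hM
      rw [← Finset.sum_subset (Finset.range_mono (by omega : n + 1 ≤ M + 1))]
      · exact Finset.sum_congr rfl fun j _ => by rw [nsmul_eq_mul, mul_comm]
      · intro j _ hj
        rw [Nat.choose_eq_zero_of_lt (by simpa using hj)]
        simp
    -- Both ranges extend to `max n K`: binomials vanish for `j > n`, differences for `j > K`.
    rw [h1 (max n K) (le_max_left _ _)]
    symm
    refine Finset.sum_subset (Finset.range_mono (by omega)) fun j _ hj => ?_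
    rw [hK j (by simpa using hj), zero_mul]
  have hterm : ∀ j ∈ Finset.range (K + 1), Tendsto
      (fun n : ℕ => (fwdDiff 1)^[j] f D * (n.choose j : ℝ) / (n : ℝ) ^ K) atTop
      (𝓝 (if j = K then (fwdDiff 1)^[K] f D / K.factorial else 0)) := by
    intro j hj
    have hpow : Tendsto (fun n : ℕ => ((n : ℝ) ^ j / j.factorial) / (n : ℝ) ^ K) atTop
        (𝓝 (if j = K then 1 / (K.factorial : ℝ) else 0)) := by
      split_ifs with hjK
      · subst hjK
        refine tendsto_const_nhds.congr' ?_
        filter_upwards [eventually_gt_atTop 0] with n hn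
        have : (n : ℝ) ^ j ≠ 0 := by positivity
        field_simp
      · have hlt : j < K := lt_of_le_of_ne (by simpa [Nat.lt_succ_iff] using hj) hjK
        have h0 := (tendsto_pow_div_pow_atTop_zero (𝕜 := ℝ) hlt).comp
          tendsto_natCast_atTop_atTop
        have h1 := h0.const_mul (1 / (j.factorial : ℝ))
        rw [mul_zero] at h1
        refine h1.congr fun n => ?_
        simp only [Function.comp_apply]
        ring
    have h := ((isEquivalent_choose j).div
      (Asymptotics.IsEquivalent.refl (u := fun n : ℕ => (n : ℝ) ^ K))).symm.tendsto_nhds hpow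
    have h2 := h.const_mul ((fwdDiff 1)^[j] f D)
    have e : (fwdDiff 1)^[j] f D * (if j = K then 1 / (K.factorial : ℝ) else 0) =
        if j = K then (fwdDiff 1)^[K] f D / K.factorial else 0 := by
      split_ifs with hjK
      · subst hjK; ring
      · ring
    rw [e] at h2
    refine h2.congr fun n => ?_
    simp only [Pi.div_apply]
    ring
  have hsum := tendsto_finsetSum _ hterm
  rw [Finset.sum_ite_eq' _ K, if_pos (by simp)] at hsum
  have hD : Tendsto (fun n : ℕ => f (n + D) / (n : ℝ) ^ K) atTop
      (𝓝 ((fwdDiff 1)^[K] f D / K.factorial)) := by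
    refine hsum.congr fun n => ?_
    rw [hnewton, Finset.sum_div]
  have hratio : Tendsto (fun n : ℕ => ((n : ℝ) / (n + D : ℝ)) ^ K) atTop (𝓝 1) := by
    simpa using (tendsto_natCast_div_add_atTop (D : ℝ)).pow K
  rw [← tendsto_add_atTop_iff_nat D]
  have := hD.mul hratio
  rw [mul_one] at this
  refine this.congr' ?_
  filter_upwards [eventually_gt_atTop 0] with n hn
  have : (n : ℝ) ^ K ≠ 0 := by positivity
  push_cast
  rw [div_pow]
  field_simp

/-- An eventually polynomial nonnegative sequence of growth order `n ^ k` has a positive normalized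
leading coefficient, which also governs its sequence of differences. -/
theorem EventuallyPolynomial.exists_tendsto {h : ℕ → ℕ} {k : ℕ}
    (hp : EventuallyPolynomial fun n => (h n : ℝ))
    (hlower : ∃ r, 0 < r ∧ ∀ n, (n + 1) ^ k ≤ h (r * n))
    (hupper : ∃ C R : ℕ, ∀ n, h n ≤ C * (R * (n + 1) + 1) ^ k) :
    ∃ e : ℝ, 0 < e ∧ Tendsto (fun n : ℕ => (k.factorial : ℝ) * ((h n : ℝ) / (n : ℝ) ^ k))
        atTop (𝓝 e) ∧
      (k ≠ 0 → Tendsto (fun n : ℕ => ((k - 1).factorial : ℝ) *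
        (((h (n + 1) : ℝ) - h n) / (n : ℝ) ^ (k - 1))) atTop (𝓝 e)) := by
  obtain ⟨N, hN⟩ := hp
  obtain ⟨D, hD⟩ := eventually_atTop.mp hN
  set f : ℕ → ℝ := fun n => (h n : ℝ) with hf
  have hc : ∀ j, N ≤ j → (fwdDiff 1)^[j] f D = 0 := by
    intro j hj
    obtain ⟨i, rfl⟩ := Nat.exists_eq_add_of_le' hj
    have : ∀ i, ∀ d ≥ D, (fwdDiff 1)^[i + N] f d = 0 := by
      intro i
      induction i with
      | zero => simpa using hD
      | succ i ih =>
        intro d hd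
        rw [show i + 1 + N = (i + N) + 1 by ring, Function.iterate_succ_apply', fwdDiff,
          ih d hd, ih (d + 1) (by omega), sub_zero]
    exact this i D le_rfl
  obtain ⟨r, hr, hlow⟩ := hlower
  obtain ⟨C, R, hup⟩ := hupper
  have hbound : ∀ K, k < K → Tendsto (fun n : ℕ => f n / (n : ℝ) ^ K) atTop (𝓝 0) := by
    intro K hK
    have h0 := ((tendsto_pow_div_pow_atTop_zero (𝕜 := ℝ) hK).comp
      tendsto_natCast_atTop_atTop).const_mul ((C : ℝ) * (2 * R + 1) ^ k)
    rw [mul_zero] at h0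
    refine squeeze_zero' (Eventually.of_forall fun n => by positivity) ?_ h0
    filter_upwards [eventually_gt_atTop 0] with n hn
    simp only [Function.comp_apply]
    rw [← mul_div_assoc, mul_assoc, ← mul_pow]
    gcongr
    have h1 : (1 : ℝ) ≤ n := by exact_mod_cast hn
    calc f n ≤ ((C * (R * (n + 1) + 1) ^ k : ℕ) : ℝ) := Nat.cast_le.mpr (hup n)
      _ = C * (R * ((n : ℝ) + 1) + 1) ^ k := by push_cast; ring
      _ ≤ _ := by
        gcongr
        nlinarith [mul_nonneg (Nat.cast_nonneg (α := ℝ) R) (sub_nonneg.mpr h1)]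
  -- Otherwise the last nonvanishing difference has order `K > k` and gives `f n / n^K` a nonzero
  -- limit, against the upper growth bound.
  have hzero : ∀ j, k < j → (fwdDiff 1)^[j] f D = 0 := by
    by_contra! hcon
    have hex : ∃ M, ∀ j, M ≤ j → (fwdDiff 1)^[j] f D = 0 := ⟨N, hc⟩
    classical
    obtain ⟨j, hj, hj0⟩ := hcon
    have hM := Nat.find_spec hex
    have hMin : ∀ m < Nat.find hex, _ := fun m hm => Nat.find_min hex hm
    set M := Nat.find hex
    have hjM : j < M := by
      by_contra! hle
      exact hj0 (hM j hle)
    obtain ⟨K, hKM⟩ : ∃ K, M = K + 1 := ⟨M - 1, by omega⟩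
    have ht := fwdDiff_iterate_tendsto (f := f) (D := D) (K := K) fun j hj => hM j (by omega)
    have h0 := tendsto_nhds_unique ht (hbound K (by omega))
    have hfac : (K.factorial : ℝ) ≠ 0 := by positivity
    rw [div_eq_zero_iff, or_iff_left hfac] at h0
    refine hMin K (by omega) fun i hi => ?_
    rcases hi.eq_or_lt with rfl | hi
    · exact h0
    · exact hM i (by omega)
  have ht := fwdDiff_iterate_tendsto (f := f) (D := D) (K := k) hzero
  have hfac : (0 : ℝ) < k.factorial := by positivity
  refine ⟨(fwdDiff 1)^[k] f D, ?_, ?_, fun hk => ?_⟩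
  · have hsub : Tendsto (fun n : ℕ => r * n) atTop atTop :=
      tendsto_id.const_mul_atTop' hr
    have hge : (1 / (r : ℝ) ^ k) ≤ (fwdDiff 1)^[k] f D / k.factorial := by
      refine ge_of_tendsto (ht.comp hsub) ?_
      filter_upwards [eventually_gt_atTop 0] with n hn
      simp only [Function.comp_apply]
      have h1 : ((n : ℝ) + 1) ^ k ≤ f (r * n) := by
        have := Nat.cast_le (α := ℝ).mpr (hlow n)
        rwa [Nat.cast_pow, Nat.cast_add, Nat.cast_one] at this
      rw [div_le_div_iff₀ (by positivity) (by positivity), one_mul]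
      push_cast
      rw [mul_pow, mul_comm]
      gcongr
      refine le_trans ?_ h1
      gcongr
      linarith
    have : 0 < (fwdDiff 1)^[k] f D / k.factorial := lt_of_lt_of_le (by positivity) hge
    rwa [div_pos_iff_of_pos_right hfac] at this
  · have := ht.const_mul (k.factorial : ℝ)
    rwa [mul_div_cancel₀ _ hfac.ne'] at this
  · obtain ⟨m, rfl⟩ := Nat.exists_eq_succ_of_ne_zero hk
    have hd := fwdDiff_iterate_tendsto (f := fwdDiff 1 f) (D := D) (K := m) fun j hj => by
      rw [← Function.iterate_succ_apply]
      exact hzero (j + 1) (by omega)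
    have hfac' : (m.factorial : ℝ) ≠ 0 := by positivity
    have := hd.const_mul (m.factorial : ℝ)
    rwa [mul_div_cancel₀ _ hfac', ← Function.iterate_succ_apply] at this

end

/-! ### Hilbert functions count standard monomials. -/

namespace GradedDegree

open MvPolynomial

variable {K : Type*} [Field K] {s : ℕ}

/-- The exponents of the leading monomials of the nonzero elements of `J`. -/
def leadingExponents (m : MonomialOrder (Fin s)) (J : Ideal (MvPolynomial (Fin s) K)) :
    Set (Fin s →₀ ℕ) :=
  {a | ∃ g ∈ J, g ≠ 0 ∧ m.degree g = a}

theorem isUpperSet_leadingExponents (m : MonomialOrder (Fin s))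
    (J : Ideal (MvPolynomial (Fin s) K)) : IsUpperSet (leadingExponents m J) := by
  classical
  rintro _ b hab ⟨g, hg, hg0, rfl⟩
  have h1 : (monomial (b - m.degree g) (1 : K)) ≠ 0 := by simp
  refine ⟨monomial (b - m.degree g) 1 * g, J.mul_mem_left _ hg, mul_ne_zero h1 hg0, ?_⟩
  rw [m.degree_mul h1 hg0, m.degree_monomial, if_neg one_ne_zero, tsub_add_cancel_of_le hab]

/-- Well-founded induction on the monomial order. The hypothesis on `T` says that `J` is stable
under truncation to `T`, so a leading monomial in `T` can be rewritten modulo `J` by smaller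
monomials that are still in `T`. -/
theorem mk_monomial_mem_map_restrictSupport (m : MonomialOrder (Fin s))
    (J : Ideal (MvPolynomial (Fin s) K)) (T : Set (Fin s →₀ ℕ))
    (hT : ∀ g ∈ J, ∃ g' ∈ J, ∀ a, (a ∈ T → coeff a g' = coeff a g) ∧ (a ∉ T → coeff a g' = 0))
    (a : Fin s →₀ ℕ) (ha : a ∈ T) :
    Ideal.Quotient.mk J (monomial a 1) ∈ (restrictSupport K (T \ leadingExponents m J)).map
      (Ideal.Quotient.mkₐ K J).toLinearMap := by
  obtain ⟨b, rfl⟩ := m.toSyn.symm.surjective a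
  induction b using WellFoundedLT.induction with
  | _ b ih =>
  by_cases hL : m.toSyn.symm b ∈ leadingExponents m J
  · obtain ⟨g, hg, hg0, hgb⟩ := hL
    obtain ⟨g', hg', hc⟩ := hT g hg
    set a := m.toSyn.symm b with hab
    have hlead : coeff a g' ≠ 0 := by
      rw [(hc a).1 ha, ← hgb]
      exact m.coeff_degree_ne_zero_iff.mpr hg0
    have hsum : Ideal.Quotient.mk J (monomial a (coeff a g')) =
        - ∑ c ∈ g'.support.erase a, Ideal.Quotient.mk J (monomial c (coeff c g')) := by
      rw [eq_neg_iff_add_eq_zero, ← map_sum, ← map_add, Ideal.Quotient.eq_zero_iff_mem]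
      rw [Finset.add_sum_erase g'.support (fun c => monomial c (coeff c g'))
        (mem_support_iff.mpr hlead), ← g'.as_sum]
      exact hg'
    have hmono : ∀ c (x : K), Ideal.Quotient.mk J (monomial c x) =
        x • Ideal.Quotient.mk J (monomial c 1) := by
      intro c x
      rw [← Ideal.Quotient.mkₐ_eq_mk K, ← map_smul, smul_monomial, smul_eq_mul, mul_one]
    rw [hmono] at hsum
    have : Ideal.Quotient.mk J (monomial a 1) =
        (coeff a g')⁻¹ • (coeff a g' • Ideal.Quotient.mk J (monomial a 1)) := by
      rw [smul_smul, inv_mul_cancel₀ hlead, one_smul]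
    rw [this, hsum]
    refine Submodule.smul_mem _ _ (Submodule.neg_mem _ (Submodule.sum_mem _ fun c hcs => ?_))
    rw [Finset.mem_erase, mem_support_iff] at hcs
    have hcT : c ∈ T := by
      by_contra h
      exact hcs.2 ((hc c).2 h)
    rw [hmono]
    refine Submodule.smul_mem _ _ ?_
    have hlt : m.toSyn c < b := by
      refine lt_of_le_of_ne ?_ fun h => hcs.1 ?_
      · have := m.le_degree (f := g) (d := c) (by
          rw [mem_support_iff, ← (hc c).1 hcT]; exact hcs.2)
        rwa [hgb, hab, AddEquiv.apply_symm_apply] at this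
      · rw [hab, ← h, AddEquiv.symm_apply_apply]
    have := ih (m.toSyn c) hlt (by rwa [AddEquiv.symm_apply_apply])
    rwa [AddEquiv.symm_apply_apply] at this
  · exact ⟨monomial _ 1, (monomial_mem_restrictSupport K).mpr (Or.inl ⟨ha, hL⟩), rfl⟩

/-- Macaulay's basis theorem: standard monomials span by rewriting, and are independent because a
nonzero element of `J` has its leading exponent in `leadingExponents m J`. Graded ideals allow `T`
to be "degree `= d`" or "degree `≤ d`". -/
theorem finrank_map_restrictSupport (m : MonomialOrder (Fin s))
    (J : Ideal (MvPolynomial (Fin s) K)) (T : Set (Fin s →₀ ℕ))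
    (hT : ∀ g ∈ J, ∃ g' ∈ J, ∀ a, (a ∈ T → coeff a g' = coeff a g) ∧ (a ∉ T → coeff a g' = 0)) :
    Module.finrank K ((restrictSupport K T).map (Ideal.Quotient.mkₐ K J).toLinearMap) =
      (T \ leadingExponents m J).ncard := by
  have heq : (restrictSupport K T).map (Ideal.Quotient.mkₐ K J).toLinearMap =
      (restrictSupport K (T \ leadingExponents m J)).map (Ideal.Quotient.mkₐ K J).toLinearMap := by
    apply le_antisymm
    · rw [restrictSupport_eq_span, Submodule.map_span_le]
      rintro _ ⟨a, ha, rfl⟩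
      exact mk_monomial_mem_map_restrictSupport m J T hT a ha
    · exact Submodule.map_mono (restrictSupport_mono K Set.sdiff_subset)
  rw [heq, ← finrank_restrictSupport (K := K), ← LinearMap.range_domRestrict]
  apply LinearMap.finrank_range_of_inj
  rw [← LinearMap.ker_eq_bot, LinearMap.ker_eq_bot']
  rintro ⟨g, hg⟩ h0
  have hgJ : g ∈ J := Ideal.Quotient.eq_zero_iff_mem.mp h0
  ext1
  by_contra hg0
  exact ((mem_restrictSupport_iff K).mp hg (m.degree_mem_support hg0)).2 ⟨g, hgJ, hg0, rfl⟩

theorem IsGraded.homogeneousComponent_mem {J : Ideal (MvPolynomial (Fin s) K)} (hJ : IsGraded J)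
    {g : MvPolynomial (Fin s) K} (hg : g ∈ J) (i : ℕ) : homogeneousComponent i g ∈ J := by
  have := hJ i hg
  rwa [← decomposition.decompose'_apply]

theorem homogeneousSubmodule_eq_restrictSupport (d : ℕ) :
    homogeneousSubmodule (Fin s) K d = restrictSupport K {a | a.degree = d} := by
  ext g
  rw [mem_homogeneousSubmodule, mem_restrictSupport_iff, IsHomogeneous, IsWeightedHomogeneous,
    Set.subset_def]
  simp only [Finset.mem_coe, mem_support_iff, Set.mem_ofPred_eq, Finsupp.degree_eq_weight_one]
  rfl

theorem restrictTotalDegree_eq_restrictSupport (d : ℕ) :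
    restrictTotalDegree (Fin s) K d = restrictSupport K {a | a.degree ≤ d} := rfl

theorem hilbertFunction_eq_finrank_map (J : Ideal (MvPolynomial (Fin s) K)) (d : ℕ) :
    hilbertFunction J d = Module.finrank K ((homogeneousSubmodule (Fin s) K d).map
      (Ideal.Quotient.mkₐ K J).toLinearMap) := by
  rw [hilbertFunction, ← LinearMap.range_domRestrict,
    ← ((Ideal.Quotient.mkₐ K J).toLinearMap.domRestrict _).quotKerEquivRange.finrank_eq]
  apply LinearEquiv.finrank_eq
  apply Submodule.quotEquivOfEq
  ext g
  exact (Ideal.Quotient.eq_zero_iff_mem (I := J) (a := g.1)).symm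

theorem hilbertFunction_eq_ncard (m : MonomialOrder (Fin s))
    {J : Ideal (MvPolynomial (Fin s) K)} (hJ : IsGraded J) (d : ℕ) :
    hilbertFunction J d = ({a | a.degree = d} \ leadingExponents m J).ncard := by
  rw [hilbertFunction_eq_finrank_map, homogeneousSubmodule_eq_restrictSupport]
  refine finrank_map_restrictSupport m J _ fun g hg =>
    ⟨homogeneousComponent d g, hJ.homogeneousComponent_mem hg d, fun a => ?_⟩
  rw [coeff_homogeneousComponent]
  exact ⟨fun h => if_pos h, fun h => if_neg h⟩

theorem affineHilbertFunction_eq_ncard (m : MonomialOrder (Fin s))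
    {J : Ideal (MvPolynomial (Fin s) K)} (hJ : IsGraded J) (d : ℕ) :
    affineHilbertFunction J d = ({a | a.degree ≤ d} \ leadingExponents m J).ncard := by
  rw [affineHilbertFunction, restrictTotalDegree_eq_restrictSupport]
  refine finrank_map_restrictSupport m J _ fun g hg =>
    ⟨∑ i ∈ Finset.range (d + 1), homogeneousComponent i g,
      Ideal.sum_mem _ fun i _ => hJ.homogeneousComponent_mem hg i, fun a => ?_⟩
  simp only [coeff_sum, coeff_homogeneousComponent, Finset.sum_ite_eq, Finset.mem_range,
    Set.mem_ofPred_eq, Nat.lt_succ_iff]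
  exact ⟨fun h => if_pos h, fun h => if_neg h⟩

theorem affineHilbertFunction_succ {J : Ideal (MvPolynomial (Fin s) K)} (hJ : IsGraded J) (d : ℕ) :
    affineHilbertFunction J (d + 1) = affineHilbertFunction J d + hilbertFunction J (d + 1) := by
  let m : MonomialOrder (Fin s) := MonomialOrder.lex
  rw [affineHilbertFunction_eq_ncard m hJ, affineHilbertFunction_eq_ncard m hJ,
    hilbertFunction_eq_ncard m hJ, ← Set.ncard_union_eq ?_
      ((Finsupp.finite_of_degree_le d).subset Set.sdiff_subset)
      ((Finsupp.finite_setOf_degree_eq (d + 1)).subset Set.sdiff_subset), ← Set.union_sdiff_distrib]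
  · congr 2
    ext a
    simp only [Set.mem_ofPred_eq, Set.mem_union]
    omega
  · rw [Set.disjoint_left]
    rintro a ⟨h1, -⟩ ⟨h2, -⟩
    simp only [Set.mem_ofPred_eq] at h1 h2
    omega

theorem eventuallyPolynomial_affineHilbertFunction {J : Ideal (MvPolynomial (Fin s) K)}
    (hJ : IsGraded J) : EventuallyPolynomial fun d => (affineHilbertFunction J d : ℝ) := by
  let m : MonomialOrder (Fin s) := MonomialOrder.lex
  apply EventuallyPolynomial.of_fwdDiff
  convert EventuallyPolynomial.comp_add_one_iff.mpr (eventuallyPolynomial_complementCount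
    (isUpperSet_leadingExponents m J) Finset.univ) using 2 with d
  rw [fwdDiff, affineHilbertFunction_succ hJ, hilbertFunction_eq_ncard m hJ, complementCount]
  push_cast
  rw [add_sub_cancel_left]
  congr 2
  ext a
  simp

end GradedDegree

/-! ### Degree as the leading coefficient of the affine Hilbert function. -/

section

open scoped Nat Topology
open Filter MvPolynomial

namespace GradedDegree

attribute [local instance] MvPolynomial.gradedAlgebra

variable {K : Type*} [Field K] {s : ℕ}

/-- Recovers an inequality of Krull dimensions from one of Hilbert functions; positivity of `a`
makes `k` the true growth order of `u`. -/
theorem le_of_tendsto_of_le {u v : ℕ → ℕ} {k l : ℕ} {a b : ℝ} (ha : 0 < a)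
    (hu : Tendsto (fun n : ℕ => (k ! : ℝ) * ((u n : ℝ) / (n : ℝ) ^ k)) atTop (𝓝 a))
    (hv : Tendsto (fun n : ℕ => (l ! : ℝ) * ((v n : ℝ) / (n : ℝ) ^ l)) atTop (𝓝 b))
    (huv : ∀ n, u n ≤ v n) : k ≤ l := by
  by_contra! h
  have h0 := (hv.mul ((tendsto_pow_div_pow_atTop_zero (𝕜 := ℝ) h).comp
    tendsto_natCast_atTop_atTop)).const_mul ((k ! : ℝ) / l !)
  rw [mul_zero, mul_zero] at h0
  refine absurd (le_of_tendsto_of_tendsto hu h0 ?_) (not_le.mpr ha)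
  filter_upwards [eventually_gt_atTop 0] with n hn
  have h1 : (n : ℝ) ≠ 0 := by positivity
  have h2 : (l ! : ℝ) ≠ 0 := by positivity
  have h3 : (u n : ℝ) ≤ v n := Nat.cast_le.mpr (huv n)
  have h4 : (k ! : ℝ) / l ! * ((l ! : ℝ) * ((v n : ℝ) / (n : ℝ) ^ l) *
      ((fun x : ℝ => x ^ l / x ^ k) ∘ fun n : ℕ => (n : ℝ)) n) =
      (k ! : ℝ) * ((v n : ℝ) / (n : ℝ) ^ k) := by
    simp only [Function.comp_apply]
    field_simp
  rw [h4]
  gcongr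

theorem exists_ringKrullDim_quotient_eq {J : Ideal (MvPolynomial (Fin s) K)} (hJ : J ≠ ⊤) :
    ∃ k : ℕ, ringKrullDim (MvPolynomial (Fin s) K ⧸ J) = k := by
  have := Ideal.Quotient.nontrivial_iff.mpr hJ
  have h0 := ringKrullDim_nonneg_of_nontrivial (R := MvPolynomial (Fin s) K ⧸ J)
  have h1 := (ringKrullDim_quotient_le J).trans_eq (ringKrullDim_fin (K := K) s)
  obtain ⟨x, hx⟩ := WithBot.ne_bot_iff_exists.mp (ne_bot_of_le_ne_bot (by simp) h0)
  rw [← hx] at h1 ⊢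
  have h2 : x ≤ (s : ℕ∞) := WithBot.coe_le_coe.mp h1
  obtain ⟨k, hk⟩ := ENat.ne_top_iff_exists.mp (ne_top_of_le_ne_top (ENat.natCast_ne_top s) h2)
  exact ⟨k, by rw [← hk]; rfl⟩

theorem eventually_affineHilbertFunction_eq_finrank (J : Ideal (MvPolynomial (Fin s) K))
    [Module.Finite K (MvPolynomial (Fin s) K ⧸ J)] :
    ∀ᶠ n in atTop, affineHilbertFunction J n = Module.finrank K (MvPolynomial (Fin s) K ⧸ J) := by
  obtain ⟨N, a, ha⟩ := Module.Finite.exists_fin (R := K) (M := MvPolynomial (Fin s) K ⧸ J)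
  choose p hp using fun i => Ideal.Quotient.mk_surjective (a i)
  filter_upwards [eventually_ge_atTop (Finset.univ.sup fun i => (p i).totalDegree)] with n hn
  suffices h : (restrictTotalDegree (Fin s) K n).map (Ideal.Quotient.mkₐ K J).toLinearMap = ⊤ by
    rw [affineHilbertFunction, h, finrank_top]
  rw [eq_top_iff, ← ha, Submodule.span_le]
  rintro _ ⟨i, rfl⟩
  refine ⟨p i, ?_, hp i⟩
  rw [SetLike.mem_coe, mem_restrictTotalDegree]
  exact (Finset.le_sup (f := fun i => (p i).totalDegree) (Finset.mem_univ i)).trans hn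

theorem dim_eq {J : Ideal (MvPolynomial (Fin s) K)} {k : ℕ}
    (hk : ringKrullDim (MvPolynomial (Fin s) K ⧸ J) = k) : dim J = k := by
  rw [dim, hk]
  rfl

/-- The degree of a proper graded quotient is well defined, positive, and equal to the normalized
leading coefficient of its affine Hilbert function. -/
theorem IsGraded.degreeExists {J : Ideal (MvPolynomial (Fin s) K)} (hJ : IsGraded J) (hJt : J ≠ ⊤)
    {k : ℕ} (hk : ringKrullDim (MvPolynomial (Fin s) K ⧸ J) = k) :
    DegreeExists J ∧ 0 < degree J ∧
      Tendsto (fun n : ℕ => (k ! : ℝ) * ((affineHilbertFunction J n : ℝ) / (n : ℝ) ^ k)) atTop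
        (𝓝 (degree J)) := by
  obtain ⟨g, hg, hfin⟩ := exists_finite_inj_algHom_quotient J hJt hk
  obtain ⟨e, he, hlim, hdiff⟩ := (eventuallyPolynomial_affineHilbertFunction hJ).exists_tendsto
    (pow_le_affineHilbertFunction g hg) (affineHilbertFunction_le g hfin)
  have hd := dim_eq hk
  suffices DegreeExists J ∧ degree J = e by
    rw [this.2]
    exact ⟨this.1, he, hlim⟩
  by_cases hk0 : k = 0
  · subst hk0
    have hfinite : Module.Finite K (MvPolynomial (Fin s) K ⧸ J) := by
      have h1 : (algebraMap K (MvPolynomial (Fin 0) K)).Finite :=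
        RingHom.Finite.of_surjective _ (C_surjective (Fin 0))
      have h2 := RingHom.Finite.comp hfin h1
      have h3 : g.toRingHom.comp (algebraMap K (MvPolynomial (Fin 0) K)) =
          algebraMap K (MvPolynomial (Fin s) K ⧸ J) := g.comp_algebraMap
      rw [h3] at h2
      exact RingHom.finite_algebraMap.mp h2
    refine ⟨⟨fun _ => hfinite, fun h => absurd hd h⟩, ?_⟩
    rw [degree, if_pos hd]
    refine tendsto_nhds_unique (tendsto_const_nhds.congr' ?_) hlim
    filter_upwards [eventually_affineHilbertFunction_eq_finrank J] with n hn
    simp [hn]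
  · have hseq : Tendsto (degreeSeq J) atTop (𝓝 e) := by
      -- The difference of the affine function at `n` is the Hilbert function at `n + 1`, divided by
      -- a power of `n`; the factor `hratio` corrects the denominator.
      rw [← tendsto_add_atTop_iff_nat 1]
      have hratio : Tendsto (fun n : ℕ => ((n : ℝ) / (n + 1 : ℝ)) ^ (k - 1)) atTop (𝓝 1) := by
        simpa using (tendsto_natCast_div_add_atTop (1 : ℝ)).pow (k - 1)
      have := (hdiff hk0).mul hratio
      rw [mul_one] at this
      refine this.congr' ?_
      filter_upwards [eventually_gt_atTop 0] with n hn
      have hn' : (n : ℝ) ≠ 0 := by positivity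
      rw [degreeSeq, hd, affineHilbertFunction_succ hJ]
      push_cast
      rw [div_pow]
      field_simp
      ring
    refine ⟨⟨fun h => absurd (hd.symm.trans h) hk0, fun _ => ⟨e, hseq⟩⟩, ?_⟩
    rw [degree, if_neg (by rwa [hd])]
    exact hseq.limUnder_eq

theorem affineHilbertFunction_anti_of_leadingExponents_subset (m : MonomialOrder (Fin s))
    {I J : Ideal (MvPolynomial (Fin s) K)} (hI : IsGraded I) (hJ : IsGraded J)
    (h : leadingExponents m I ⊆ leadingExponents m J) (n : ℕ) :
    affineHilbertFunction J n ≤ affineHilbertFunction I n := by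
  rw [affineHilbertFunction_eq_ncard m hI, affineHilbertFunction_eq_ncard m hJ]
  exact Set.ncard_le_ncard (Set.sdiff_subset_sdiff_right h)
    ((Finsupp.finite_of_degree_le n).subset Set.sdiff_subset)

theorem _root_.Submodule.finrank_map_eq_finrank_map_of_ker_eq {V W W' : Type*} [AddCommGroup V]
    [Module K V] [AddCommGroup W] [Module K W] [AddCommGroup W'] [Module K W'] (u : V →ₗ[K] W)
    (ψ : V →ₗ[K] W') (B : Submodule K V) (h : ∀ v, u v = 0 ↔ ψ v = 0) :
    Module.finrank K (B.map u) = Module.finrank K (B.map ψ) := by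
  rw [← LinearMap.range_domRestrict, ← LinearMap.range_domRestrict,
    ← (u.domRestrict B).quotKerEquivRange.finrank_eq,
    ← (ψ.domRestrict B).quotKerEquivRange.finrank_eq]
  apply LinearEquiv.finrank_eq
  apply Submodule.quotEquivOfEq
  ext v
  exact h v

/-- Filtered form of `0 → S/(I : f) → S/I → S/(I,f) → 0`, the first map being multiplication by `f`.
Only an inequality results, since the kernel in bounded degree may exceed the multiples of `f` by
polynomials of degree at most `d`. -/
theorem affineHilbertFunction_sup_add_colon_le (I : Ideal (MvPolynomial (Fin s) K))
    (f : MvPolynomial (Fin s) K) (d : ℕ) :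
    affineHilbertFunction (I ⊔ Ideal.span {f}) (d + f.totalDegree) +
      affineHilbertFunction (I.colon {f}) d ≤ affineHilbertFunction I (d + f.totalDegree) := by
  let n := d + f.totalDegree
  let A := (restrictTotalDegree (Fin s) K n).map (Ideal.Quotient.mkₐ K I).toLinearMap
  let π : (MvPolynomial (Fin s) K ⧸ I) →ₗ[K] (MvPolynomial (Fin s) K ⧸ (I ⊔ Ideal.span {f})) :=
    (Ideal.Quotient.factorₐ K le_sup_left).toLinearMap
  let ψ : MvPolynomial (Fin s) K →ₗ[K] (MvPolynomial (Fin s) K ⧸ I) :=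
    (Ideal.Quotient.mkₐ K I).toLinearMap ∘ₗ LinearMap.mulLeft K f
  let B := restrictTotalDegree (Fin s) K d
  let C := B.map (Ideal.Quotient.mkₐ K (I.colon {f})).toLinearMap
  have hker : ∀ q, ψ q = 0 ↔ Ideal.Quotient.mkₐ K (I.colon {f}) q = 0 := by
    intro q
    change Ideal.Quotient.mk I (f * q) = 0 ↔ Ideal.Quotient.mk _ q = 0
    rw [Ideal.Quotient.eq_zero_iff_mem, Ideal.Quotient.eq_zero_iff_mem,
      Submodule.mem_colon_singleton, smul_eq_mul, mul_comm]
  have hC : Module.finrank K C = Module.finrank K (B.map ψ) :=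
    Submodule.finrank_map_eq_finrank_map_of_ker_eq _ _ B fun q => (hker q).symm
  have hBA : B.map ψ ≤ A := by
    rintro _ ⟨q, hq, rfl⟩
    refine ⟨f * q, ?_, rfl⟩
    rw [SetLike.mem_coe, mem_restrictTotalDegree] at hq ⊢
    exact (totalDegree_mul _ _).trans (by omega)
  have hπ : Module.finrank K (A.map π) = affineHilbertFunction (I ⊔ Ideal.span {f}) n := by
    rw [affineHilbertFunction, ← Submodule.map_comp]
    rfl
  have hle : Module.finrank K (B.map ψ) ≤ Module.finrank K (LinearMap.ker (π.domRestrict A)) := by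
    have : ∀ x : B.map ψ, (⟨x.1, hBA x.2⟩ : A) ∈ LinearMap.ker (π.domRestrict A) := by
      rintro ⟨_, q, hq, rfl⟩
      rw [LinearMap.mem_ker]
      change Ideal.Quotient.mk (I ⊔ Ideal.span {f}) (f * q) = 0
      rw [Ideal.Quotient.eq_zero_iff_mem]
      exact Ideal.mul_mem_right _ _ (Ideal.mem_sup_right (Ideal.mem_span_singleton_self f))
    refine LinearMap.finrank_le_finrank_of_injective
      (f := ((Submodule.inclusion hBA).codRestrict _ this)) ?_
    intro x y hxy
    ext1
    exact congrArg (fun z => z.1.1) hxy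
  have hrn := LinearMap.finrank_range_add_finrank_ker (π.domRestrict A)
  rw [LinearMap.range_domRestrict, hπ] at hrn
  change affineHilbertFunction (I ⊔ Ideal.span {f}) n + Module.finrank K C ≤ Module.finrank K A
  rw [hC]
  omega

theorem isGraded_span {S : Set (MvPolynomial (Fin s) K)} (hS : ∀ g ∈ S, ∃ n, g.IsHomogeneous n) :
    IsGraded (Ideal.span S) :=
  Ideal.homogeneous_span _ _ hS

theorem IsGraded.sup {I J : Ideal (MvPolynomial (Fin s) K)} (hI : IsGraded I) (hJ : IsGraded J) :
    IsGraded (I ⊔ J) :=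
  Ideal.IsHomogeneous.sup hI hJ

theorem exists_isHomogeneous_initialMonomial (m : MonomialOrder (Fin s))
    (g : MvPolynomial (Fin s) K) : ∃ n, (initialMonomial m g).IsHomogeneous n := by
  rw [initialMonomial]
  split_ifs
  · exact ⟨0, isHomogeneous_zero _ _ _⟩
  · exact ⟨_, isHomogeneous_monomial _ rfl⟩

theorem initialMonomial_of_ne_zero (m : MonomialOrder (Fin s)) {g : MvPolynomial (Fin s) K}
    (hg : g ≠ 0) : initialMonomial m g = monomial (m.degree g) 1 := if_neg hg

/-! ### Leading exponents of the ideal generated by `in(I)` and `in(f)`. -/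

section InitialIdeal

variable (m : MonomialOrder (Fin s)) (I : Ideal (MvPolynomial (Fin s) K))
  (f : MvPolynomial (Fin s) K)

theorem isGraded_initialIdeal_sup :
    IsGraded (initialIdeal m I ⊔ Ideal.span {initialMonomial m f}) := by
  rw [initialIdeal, ← Ideal.span_union]
  apply isGraded_span
  rintro _ (⟨g, -, rfl⟩ | rfl) <;> exact exists_isHomogeneous_initialMonomial m _

theorem leadingExponents_subset_initialIdeal_sup :
    leadingExponents m I ⊆
      leadingExponents m (initialIdeal m I ⊔ Ideal.span {initialMonomial m f}) := by
  classical
  rintro _ ⟨g, hg, hg0, rfl⟩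
  refine ⟨monomial (m.degree g) 1, Ideal.mem_sup_left (Ideal.subset_span ⟨g, hg, ?_⟩), by simp, ?_⟩
  · exact initialMonomial_of_ne_zero m hg0
  · rw [m.degree_monomial, if_neg one_ne_zero]

/-- The left ideal sits in the monomial ideal spanned by leading monomials of `(I,f)`, where every
monomial of every element is divisible by a generator. -/
theorem leadingExponents_initialIdeal_sup_subset :
    leadingExponents m (initialIdeal m I ⊔ Ideal.span {initialMonomial m f}) ⊆
      leadingExponents m (I ⊔ Ideal.span {f}) := by
  have hle : initialIdeal m I ⊔ Ideal.span {initialMonomial m f} ≤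
      Ideal.span ((fun a => monomial a (1 : K)) '' leadingExponents m (I ⊔ Ideal.span {f})) := by
    have key : ∀ g ∈ I ⊔ Ideal.span {f}, initialMonomial m g ∈
        Ideal.span ((fun a => monomial a (1 : K)) '' leadingExponents m (I ⊔ Ideal.span {f})) := by
      intro g hg
      by_cases hg0 : g = 0
      · rw [initialMonomial, if_pos hg0]; exact Ideal.zero_mem _
      · rw [initialMonomial_of_ne_zero m hg0]
        exact Ideal.subset_span ⟨_, ⟨g, hg, hg0, rfl⟩, rfl⟩
    rw [initialIdeal, ← Ideal.span_union, Ideal.span_le]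
    rintro _ (⟨g, hg, rfl⟩ | rfl)
    · exact key g (Ideal.mem_sup_left hg)
    · exact key f (Ideal.mem_sup_right (Ideal.mem_span_singleton_self f))
  rintro _ ⟨g, hg, hg0, rfl⟩
  obtain ⟨a, ha, hle'⟩ := mem_ideal_span_monomial_image.mp (hle hg) _ (m.degree_mem_support hg0)
  exact isUpperSet_leadingExponents m _ hle' ha

variable {I} in
theorem eq_top_of_zero_mem_leadingExponents (h : 0 ∈ leadingExponents m I) : I = ⊤ := by
  obtain ⟨g, hg, hg0, hd⟩ := h
  rw [m.eq_C_of_degree_eq_zero hd] at hg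
  refine Ideal.eq_top_of_isUnit_mem _ hg ?_
  exact (isUnit_iff_ne_zero.mpr (m.leadingCoeff_ne_zero_iff.mpr hg0)).map C

theorem initialIdeal_sup_ne_top (h : I ⊔ Ideal.span {f} ≠ ⊤) :
    initialIdeal m I ⊔ Ideal.span {initialMonomial m f} ≠ ⊤ := by
  intro htop
  refine h (eq_top_of_zero_mem_leadingExponents m
    (leadingExponents_initialIdeal_sup_subset m I f ?_))
  exact ⟨1, htop ▸ Submodule.mem_top, one_ne_zero, m.degree_one⟩

end InitialIdeal

/-! ### Dimension of unmixed quotients and the strict inequality. -/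

/-- The dimension of `S/I` is controlled by minimal primes; these are associated, so they share the
height of `p` and hence its quotient dimension. -/
theorem IsUnmixed.ringKrullDim_quotient_eq {I : Ideal (MvPolynomial (Fin s) K)} (hI : IsUnmixed I)
    (p : Ideal (MvPolynomial (Fin s) K)) (hp : p.IsPrime ∧ ∃ g, p = I.colon {g}) :
    ringKrullDim (MvPolynomial (Fin s) K ⧸ p) = ringKrullDim (MvPolynomial (Fin s) K ⧸ I) := by
  have hle : I ≤ p := by
    obtain ⟨g, rfl⟩ := hp.2
    intro x hx
    rw [Submodule.mem_colon_singleton]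
    exact I.mul_mem_right _ hx
  refine le_antisymm (ringKrullDim_le_of_surjective _ (Ideal.Quotient.factor_surjective hle)) ?_
  refine ringKrullDim_quotient_le_of_minimalPrimes fun q hq => ?_
  have hqa := Submodule.mem_associatedPrimes_of_mem_minimalPrimes hq
  have := hp.1
  have := hqa.1
  exact (ringKrullDim_quotient_eq_of_height_eq q p (hI q p hqa hp)).le

theorem IsUnmixed.ringKrullDim_quotient_eq_of_le {I J p : Ideal (MvPolynomial (Fin s) K)}
    (hI : IsUnmixed I) (hp : p.IsPrime ∧ ∃ g, p = I.colon {g}) (hIJ : I ≤ J) (hJp : J ≤ p) :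
    ringKrullDim (MvPolynomial (Fin s) K ⧸ J) = ringKrullDim (MvPolynomial (Fin s) K ⧸ I) :=
  le_antisymm (ringKrullDim_le_of_surjective _ (Ideal.Quotient.factor_surjective hIJ))
    ((hI.ringKrullDim_quotient_eq p hp).symm.trans_le
      (ringKrullDim_le_of_surjective _ (Ideal.Quotient.factor_surjective hJp)))

theorem degree_sup_span_singleton_lt {I : Ideal (MvPolynomial (Fin s) K)}
    {f : MvPolynomial (Fin s) K} {k : ℕ} {a b : ℝ} (hne : I.colon {f} ≠ ⊤)
    (hk : ringKrullDim (MvPolynomial (Fin s) K ⧸ I.colon {f}) = k)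
    (ha : Tendsto (fun n : ℕ => (k ! : ℝ) *
      ((affineHilbertFunction (I ⊔ Ideal.span {f}) n : ℝ) / (n : ℝ) ^ k)) atTop (𝓝 a))
    (hb : Tendsto (fun n : ℕ => (k ! : ℝ) *
      ((affineHilbertFunction I n : ℝ) / (n : ℝ) ^ k)) atTop (𝓝 b)) : a < b := by
  obtain ⟨g, hg, -⟩ := exists_finite_inj_algHom_quotient _ hne hk
  obtain ⟨r, hr, hlow⟩ := pow_le_affineHilbertFunction g hg
  let n := f.totalDegree
  have hsub : Tendsto (fun d : ℕ => r * d + n) atTop atTop :=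
    tendsto_atTop_mono (fun d => Nat.le_add_right _ n) (tendsto_id.const_mul_atTop' hr)
  have hlim := (hb.sub ha).comp hsub
  -- The gap survives in the limit because `r * d + n ≤ (d + 1) * (r + n)`, while the difference of
  -- Hilbert functions at `r * d + n` is at least `(d + 1)^k`.
  have hpos : (0 : ℝ) < k ! / ((r : ℝ) + n) ^ k := by positivity
  refine sub_pos.mp (lt_of_lt_of_le hpos (ge_of_tendsto hlim ?_))
  filter_upwards [eventually_gt_atTop 0] with d hd
  simp only [Function.comp_apply]
  rw [← mul_sub, ← sub_div, div_eq_mul_one_div]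
  refine mul_le_mul_of_nonneg_left ?_ (by positivity)
  have h1 : ((d : ℝ) + 1) ^ k ≤ (affineHilbertFunction I (r * d + n) : ℝ) -
      affineHilbertFunction (I ⊔ Ideal.span {f}) (r * d + n) := by
    have h2 : affineHilbertFunction (I ⊔ Ideal.span {f}) (r * d + n) + _ ≤
        affineHilbertFunction I (r * d + n) := affineHilbertFunction_sup_add_colon_le I f (r * d)
    have h3 := hlow d
    rw [le_sub_iff_add_le]
    exact_mod_cast (by omega : (d + 1) ^ k +
      affineHilbertFunction (I ⊔ Ideal.span {f}) (r * d + n) ≤ affineHilbertFunction I (r * d + n))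
  rw [div_le_div_iff₀ (by positivity) (by positivity), one_mul]
  push_cast
  calc ((r : ℝ) * d + n) ^ k ≤ (((d : ℝ) + 1) * (r + n)) ^ k := by
        gcongr
        have := mul_nonneg (Nat.cast_nonneg (α := ℝ) d) (Nat.cast_nonneg (α := ℝ) n)
        have := Nat.cast_nonneg (α := ℝ) r
        nlinarith
    _ = ((d : ℝ) + 1) ^ k * (r + n) ^ k := mul_pow _ _ _
    _ ≤ _ := mul_le_mul_of_nonneg_right h1 (by positivity)

end GradedDegree

end

/-! ### The main theorem. -/

theorem lemma4p1 {K : Type*} [Field K] {s : ℕ} (m : MonomialOrder (Fin s))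
    (I : Ideal (MvPolynomial (Fin s) K)) (hI : GradedDegree.IsGraded I)
    (hunm : GradedDegree.IsUnmixed I)
    (f : MvPolynomial (Fin s) K) (hf : ∃ n : ℕ, f.IsHomogeneous n)
    (hzd : I.colon {f} ≠ I) :
    -- the three degrees are well defined
    (GradedDegree.DegreeExists (I ⊔ Ideal.span {f}) ∧
      GradedDegree.DegreeExists
        (GradedDegree.initialIdeal m I ⊔ Ideal.span {GradedDegree.initialMonomial m f}) ∧
      GradedDegree.DegreeExists I) ∧
    GradedDegree.degree (I ⊔ Ideal.span {f}) ≤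
      GradedDegree.degree
        (GradedDegree.initialIdeal m I ⊔ Ideal.span {GradedDegree.initialMonomial m f}) ∧
    GradedDegree.degree
        (GradedDegree.initialIdeal m I ⊔ Ideal.span {GradedDegree.initialMonomial m f}) ≤
      GradedDegree.degree I ∧
    (I.IsRadical → f ∉ I →
      GradedDegree.degree (I ⊔ Ideal.span {f}) < GradedDegree.degree I) := by
  have hcolon : I ≤ I.colon {f} := fun x hx => by
    rw [Submodule.mem_colon_singleton]
    exact I.mul_mem_right _ hx
  obtain ⟨h, hhf, hhI⟩ : ∃ h ∈ I.colon {f}, h ∉ I :=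
    Set.not_subset.mp fun hle => hzd (le_antisymm hle hcolon)
  rw [Submodule.mem_colon_singleton, smul_eq_mul] at hhf
  -- As `h * f ∈ I` with `h ∉ I`, the form `f` lies in `(I : h)`, hence in an associated prime.
  obtain ⟨p, hp, hhp⟩ := Ideal.exists_isPrime_colon_le_colon hhI
  have hfp : f ∈ p := hhp (by rwa [Submodule.mem_colon_singleton, smul_eq_mul, mul_comm])
  have hIp : I ≤ p := fun x hx =>
    hhp (by rw [Submodule.mem_colon_singleton]; exact I.mul_mem_right _ hx)
  have hJp : I ⊔ Ideal.span {f} ≤ p :=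
    sup_le hIp ((Ideal.span_singleton_le_iff_mem _).mpr hfp)
  have hItop : I ≠ ⊤ := ne_top_of_le_ne_top hp.1.ne_top hIp
  have hJtop : I ⊔ Ideal.span {f} ≠ ⊤ := ne_top_of_le_ne_top hp.1.ne_top hJp
  have hMtop := GradedDegree.initialIdeal_sup_ne_top m I f hJtop
  have hJ : GradedDegree.IsGraded (I ⊔ Ideal.span {f}) :=
    hI.sup (GradedDegree.isGraded_span fun g hg => (Set.mem_singleton_iff.mp hg) ▸ hf)
  have hM := GradedDegree.isGraded_initialIdeal_sup m I f
  obtain ⟨k, hk⟩ := GradedDegree.exists_ringKrullDim_quotient_eq hItop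
  obtain ⟨l, hl⟩ := GradedDegree.exists_ringKrullDim_quotient_eq hMtop
  have hkJ := (hunm.ringKrullDim_quotient_eq_of_le hp le_sup_left hJp).trans hk
  obtain ⟨eI, pI, tI⟩ := hI.degreeExists hItop hk
  obtain ⟨eJ, pJ, tJ⟩ := hJ.degreeExists hJtop hkJ
  obtain ⟨eM, pM, tM⟩ := hM.degreeExists hMtop hl
  have hJM := GradedDegree.affineHilbertFunction_anti_of_leadingExponents_subset m hM hJ
    (GradedDegree.leadingExponents_initialIdeal_sup_subset m I f)
  have hMI := GradedDegree.affineHilbertFunction_anti_of_leadingExponents_subset m hI hM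
    (GradedDegree.leadingExponents_subset_initialIdeal_sup m I f)
  -- The dimension of the middle quotient is squeezed between the two outer ones, both equal to `k`.
  obtain rfl : k = l := le_antisymm (GradedDegree.le_of_tendsto_of_le pJ tJ tM hJM)
    (GradedDegree.le_of_tendsto_of_le pM tM tI hMI)
  refine ⟨⟨eJ, eM, eI⟩, le_of_tendsto_of_tendsto' tJ tM fun n => ?_,
    le_of_tendsto_of_tendsto' tM tI fun n => ?_, fun _ hfI => ?_⟩
  · have := Nat.cast_le (α := ℝ).mpr (hJM n)
    gcongr
  · have := Nat.cast_le (α := ℝ).mpr (hMI n)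
    gcongr
  · obtain ⟨q, hq, hfq⟩ := Ideal.exists_isPrime_colon_le_colon hfI
    exact GradedDegree.degree_sup_span_singleton_lt (ne_top_of_le_ne_top hq.1.ne_top hfq)
      ((hunm.ringKrullDim_quotient_eq_of_le hq hcolon hfq).trans hk) tJ tI
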